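/- Let $\mathbf x=(x_1,\dots,x_n)^\top\sim\mathcal N_n(\boldsymbol\mu,\boldsymbol\Sigma)$ with $\boldsymbol\Sigma$ (symmetric) positive definite, and let $p$ be its density. Let $M\ge 0$ and $J_1,\dots,J_M$ be non-negative integers, and let the variables $x_1,\dots,x_n$ be partitioned into pairwise disjoint (possibly empty) sets $\mathcal X_{j_1,\dots,j_m}$, indexed by the tuples $(j_1,\dots,j_m)$ with $0\le m\le M$ and $1\le j_k\le J_k$ (for $m=0$ there is one set, $\mathcal X$). Assume that the variables are ordered by resolution: if $i>j$, $x_i\in\mathcal X_{j_1,\dots,j_m}$ and $x_j\in\mathcal X_{k_1,\dots,k_l}$, then $m\ge l$. Let $\mathcal A_{j_1,\dots,j_m}=\mathcal X\cup\mathcal X_{j_1}\cup\dots\cup\mathcal X_{j_1,\dots,j_{m-1}}$ (empty for $m=0$) and, for $x_i\in\mathcal X_{j_1,\dots,j_m}$, let $\mathcal C_i=\mathcal A_{j_1,\dots,j_m}\cup\{x_k\in\mathcal X_{j_1,\dots,j_m}:k<i\}$. The hierarchical Vecchia approximation of $p$ is $$\hat p(\mathbf x)=\prod_{m=0}^M\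 \prod_{j_1,\dots,j_m}p(\mathcal X_{j_1,\dots,j_m}\mid\mathcal A_{j_1,\dots,j_m}),$$ where the factors are the conditional densities derived from $p$ (a marginal density being obtained by integrating out the other variables, and a conditional density being the quotient of the joint and the marginal density). Then there is a positive definite matrix $\hat{\boldsymbol\Sigma}$ such that $\hat p(\mathbf x)=\mathcal N_n(\mathbf x\mid\boldsymbol\mu,\hat{\boldsymbol\Sigma})$ for all $\mathbf x\in\mathbb R^n$. For a positive definite matrix $\mathbf A$, let $\operatorname{chol}(\mathbf A)$ be its Cholesky factor, that is, the lower triangular matrix $\mathbf B$ with positive diagonal and $\mathbf B\mathbf B^\top=\mathbf A$. Let $\mathbf L=\operatorname{chol}(\hat{\boldsymbol\Sigma})$ and $\mathbf U=\mathbf P\operatorname{chol}(\mathbf P\hat{\boldsymbol\Sigma}^{-1}\mathbf P)\,\mathbf P$, where $\mathbf P$ is the order-reversing permutation matrix. Then: 1. for all $i\ne j$ with $x_j\notin\mathcal C_i$: (a) $\mathbf L_{i,j}=0$, and (b) $\mathbf U_{j,i}=0$; 2. $\mathbf U=\mathbf L^{-\top}$. -/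

import Mathlib

open MeasureTheory

namespace HierVecchia

/-- The density of the nondegenerate Gaussian distribution on `ℝⁿ` with mean `μ` and (positive
definite) covariance matrix `S`, as a real number. -/
noncomputable def gaussianDensityReal {n : ℕ} (μ : Fin n → ℝ) (S : Matrix (Fin n) (Fin n) ℝ)
    (x : Fin n → ℝ) : ℝ :=
  (Real.sqrt ((2 * Real.pi) ^ n * S.det))⁻¹ *
    Real.exp (-(dotProduct (x - μ) (Matrix.mulVec S⁻¹ (x - μ))) / 2)

/-- The Gaussian density, with values in `[0, ∞]`. -/
noncomputable def gaussianDensity {n : ℕ} (μ : Fin n → ℝ) (S : Matrix (Fin n) (Fin n) ℝ)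
    (x : Fin n → ℝ) : ENNReal :=
  ENNReal.ofReal (gaussianDensityReal μ S x)

/-- The marginal density of the variables with index in `A` under the joint density `p`: all the
variables with index outside `A` are integrated out. It is written as a function of the whole
vector `x`, but depends only on the coordinates in `A`. -/
noncomputable def marginalDensity {n : ℕ} (p : (Fin n → ℝ) → ENNReal) (A : Finset (Fin n))
    (x : Fin n → ℝ) : ENNReal :=
  lmarginal (fun _ : Fin n => (volume : Measure ℝ)) Aᶜ p x

/-- The conditional density of the variables with index in `B`, given those with index in `A`
(for disjoint `A` and `B`), under the joint density `p`. -/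
noncomputable def condDensity {n : ℕ} (p : (Fin n → ℝ) → ENNReal) (B A : Finset (Fin n))
    (x : Fin n → ℝ) : ENNReal :=
  marginalDensity p (A ∪ B) x / marginalDensity p A x

/-- Multi-indices `(j₁, …, jₘ)` of length `m`, where the `(k+1)`-st entry ranges over a set of
`J k` elements. -/
abbrev MultiIndex (J : ℕ → ℕ) (m : ℕ) : Type := (k : Fin m) → Fin (J k)

/-- The multi-indices of all lengths (resolutions) `m = 0, …, M`. -/
abbrev Node (M : ℕ) (J : ℕ → ℕ) : Type := (m : Fin (M + 1)) × MultiIndex J m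

/-- The initial segment `(j₁, …, jₗ)`, `l < m`, of the multi-index `(j₁, …, jₘ)`. -/
def Node.truncate {M : ℕ} {J : ℕ → ℕ} (a : Node M J) (l : Fin a.1) : Node M J :=
  ⟨⟨l, l.isLt.trans a.1.isLt⟩, fun k => a.2 ⟨k, k.isLt.trans l.isLt⟩⟩

/-- A hierarchical partition of (the indices of) the variables `x₁, …, xₙ` into sets
`𝒳_{j₁,…,jₘ}`, `0 ≤ m ≤ M`, such that the variables are ordered by resolution. Sets of the family
may be empty. -/
structure HierPartition (n M : ℕ) (J : ℕ → ℕ) where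
  /-- the set `𝒳_{j₁,…,jₘ}` -/
  block : Node M J → Finset (Fin n)
  disjoint : ∀ a b, a ≠ b → Disjoint (block a) (block b)
  cover : ∀ i, ∃ a, i ∈ block a
  ordered : ∀ (i j : Fin n) (a b : Node M J), j < i → i ∈ block a → j ∈ block b → b.1 ≤ a.1

namespace HierPartition

variable {n M : ℕ} {J : ℕ → ℕ} (X : HierPartition n M J)

/-- The set of ancestors `𝒜_{j₁,…,jₘ} = 𝒳 ∪ 𝒳_{j₁} ∪ … ∪ 𝒳_{j₁,…,jₘ₋₁}`. -/
def ancestors (a : Node M J) : Finset (Fin n) :=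
  Finset.univ.biUnion fun l : Fin a.1 => X.block (a.truncate l)

/-- The conditioning set `𝒞ᵢ = 𝒜_{j₁,…,jₘ} ∪ {xₖ ∈ 𝒳_{j₁,…,jₘ} : k < i}` of
`xᵢ ∈ 𝒳_{j₁,…,jₘ}`. -/
def condSet (i : Fin n) : Finset (Fin n) :=
  Finset.univ.filter fun k =>
    ∃ a : Node M J, i ∈ X.block a ∧ (k ∈ X.ancestors a ∨ (k ∈ X.block a ∧ k < i))

/-- The hierarchical Vecchia approximation of the joint density `p`, which is
`∏_{m=0}^M ∏_{j₁,…,jₘ} p(𝒳_{j₁,…,jₘ} | 𝒜_{j₁,…,jₘ})`. -/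
noncomputable def approx (p : (Fin n → ℝ) → ENNReal) (x : Fin n → ℝ) : ENNReal :=
  ∏ a : Node M J, condDensity p (X.block a) (X.ancestors a) x

end HierPartition

/-- `L` is the Cholesky factor of `A`: it is lower triangular with positive diagonal, and
`L Lᵀ = A`. -/
def IsChol {n : ℕ} (A L : Matrix (Fin n) (Fin n) ℝ) : Prop :=
  (∀ i j, i < j → L i j = 0) ∧ (∀ i, 0 < L i i) ∧ L * L.transpose = A

open Classical in
/-- The Cholesky factor of a matrix (it is unique if it exists, and zero by convention if there
is none). -/
noncomputable def chol {n : ℕ} (A : Matrix (Fin n) (Fin n) ℝ) : Matrix (Fin n) (Fin n) ℝ :=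
  if h : ∃ L, IsChol A L then h.choose else 0

/-- The reverse-ordering permutation matrix. -/
def reversal (n : ℕ) : Matrix (Fin n) (Fin n) ℝ :=
  Fin.revPerm.permMatrix ℝ

/-- The reverse-ordered Cholesky factor `P chol(P A P) P`. -/
noncomputable def rchol {n : ℕ} (A : Matrix (Fin n) (Fin n) ℝ) : Matrix (Fin n) (Fin n) ℝ :=
  reversal n * chol (reversal n * A * reversal n) * reversal n

end HierVecchia

namespace HierVecchia

open Matrix

/-! By the chain rule the approximation equals `∏ᵢ p(xᵢ | 𝒞ᵢ)` (`approx_eq_prod`). Completing the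
square (`IsGaussianOn.integrate_out`) shows that each factor is a constant times `exp (-(Wᵢ ⬝ᵥ (x -
μ))² / 2)`, where the row `Wᵢ` has `Wᵢᵢ > 0` and vanishes off `{i} ∪ 𝒞ᵢ`. As `𝒞ᵢ` contains only
indices below `i`, the matrix `W` is lower triangular, and the product is the Gaussian density with
precision `Wᵀ W`.

Uniqueness of Cholesky factors then gives `L = W⁻¹` and `U = Wᵀ`, hence `U = L⁻ᵀ`. The zeros of `U`
are those of `W`. Inversion preserves them because membership in conditioning sets is transitive
(`condSet_trans`, `apply_eq_zero_of_mul_eq_one`); this is where the hierarchy matters. -/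

/-- `f` is, up to a positive constant, the exponential of minus half a quadratic form in `x - μ`
which involves only the coordinates in `A` and is positive definite in these. -/
def IsGaussianOn {n : ℕ} (μ : Fin n → ℝ) (A : Finset (Fin n)) (f : (Fin n → ℝ) → ENNReal) : Prop :=
  ∃ c : ℝ, 0 < c ∧ ∃ Q : Matrix (Fin n) (Fin n) ℝ, (∀ j k, Q j k = Q k j) ∧
    (∀ j, j ∉ A → ∀ k, Q j k = 0) ∧
    (∀ y : Fin n → ℝ, (∀ j, j ∉ A → y j = 0) → y ≠ 0 → 0 < y ⬝ᵥ Q *ᵥ y) ∧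
    ∀ x, f x = ENNReal.ofReal (c * Real.exp (-((x - μ) ⬝ᵥ Q *ᵥ (x - μ)) / 2))

/-! ### Gaussian marginals and conditionals -/

theorem IsGaussianOn.ne_zero {n : ℕ} {μ : Fin n → ℝ} {A : Finset (Fin n)}
    {f : (Fin n → ℝ) → ENNReal} (h : IsGaussianOn μ A f) (x : Fin n → ℝ) : f x ≠ 0 := by
  obtain ⟨c, hc, Q, -, -, -, hf⟩ := h
  rw [hf, ne_eq, ENNReal.ofReal_eq_zero, not_le]
  positivity

theorem IsGaussianOn.ne_top {n : ℕ} {μ : Fin n → ℝ} {A : Finset (Fin n)}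
    {f : (Fin n → ℝ) → ENNReal} (h : IsGaussianOn μ A f) (x : Fin n → ℝ) : f x ≠ ⊤ := by
  obtain ⟨c, hc, Q, -, -, -, hf⟩ := h
  rw [hf]
  exact ENNReal.ofReal_ne_top

theorem isGaussianOn_gaussianDensity {n : ℕ} (μ : Fin n → ℝ) {S : Matrix (Fin n) (Fin n) ℝ}
    (hS : S.PosDef) : IsGaussianOn μ Finset.univ (gaussianDensity μ S) := by
  have hdet := hS.det_pos
  refine ⟨(Real.sqrt ((2 * Real.pi) ^ n * S.det))⁻¹, by positivity, S⁻¹, ?_, by simp, ?_, ?_⟩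
  · intro j k
    simpa using hS.inv.1.apply k j
  · intro y _ hy
    simpa using hS.inv.dotProduct_mulVec_pos hy
  · intro x
    rfl

theorem measurable_gaussianDensity {n : ℕ} (μ : Fin n → ℝ) (S : Matrix (Fin n) (Fin n) ℝ) :
    Measurable (gaussianDensity μ S) := by
  unfold gaussianDensity gaussianDensityReal
  refine ENNReal.measurable_ofReal.comp (Continuous.measurable ?_)
  have h1 : Continuous fun x : Fin n → ℝ => S⁻¹ *ᵥ (x - μ) :=
    Continuous.matrix_mulVec continuous_const (by fun_prop)
  have h2 : Continuous fun x : Fin n → ℝ => (x - μ) ⬝ᵥ (S⁻¹ *ᵥ (x - μ)) :=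
    Continuous.dotProduct (by fun_prop) h1
  fun_prop

theorem lintegral_exp_neg_sq_affine {a : ℝ} (ha : 0 < a) (b : ℝ) :
    ∫⁻ t : ℝ, ENNReal.ofReal (Real.exp (-(a * t + b) ^ 2 / 2)) =
      ENNReal.ofReal (Real.sqrt (2 * Real.pi) / a) := by
  have h0 : (fun t : ℝ => Real.exp (-(a * t + b) ^ 2 / 2)) =
      fun t : ℝ => Real.exp (-(a ^ 2 / 2) * (t + b / a) ^ 2) := by
    funext t
    congr 1
    field_simp
  have hint : Integrable fun t : ℝ => Real.exp (-(a * t + b) ^ 2 / 2) := by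
    rw [h0]
    exact (integrable_exp_neg_mul_sq (by positivity)).comp_add_right (b / a)
  rw [← ofReal_integral_eq_lintegral_ofReal hint (ae_of_all _ fun t => (Real.exp_pos _).le), h0,
    integral_add_right_eq_self (fun t : ℝ => Real.exp (-(a ^ 2 / 2) * t ^ 2)) (b / a),
    integral_gaussian]
  congr 1
  rw [show Real.pi / (a ^ 2 / 2) = 2 * Real.pi / a ^ 2 by field_simp,
    Real.sqrt_div (by positivity), Real.sqrt_sq ha.le]

/-- Integrating out one variable of a Gaussian density by completing the square. -/
theorem IsGaussianOn.integrate_out {n : ℕ} {μ : Fin n → ℝ} {A : Finset (Fin n)} {i : Fin n}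
    (hi : i ∉ A) {f g : (Fin n → ℝ) → ENNReal} (hf : IsGaussianOn μ (insert i A) f)
    (hg : ∀ x, g x = ∫⁻ t : ℝ, f (Function.update x i t)) :
    IsGaussianOn μ A g ∧
      ∃ l : Fin n → ℝ, 0 < l i ∧ (∀ j, j ≠ i → j ∉ A → l j = 0) ∧
        ∀ x, f x / g x = ENNReal.ofReal
          (l i / Real.sqrt (2 * Real.pi) * Real.exp (-(l ⬝ᵥ (x - μ)) ^ 2 / 2)) := by
  obtain ⟨c, hc, Q, hsymm, hsupp, hpos, hf⟩ := hf
  have hQii : 0 < Q i i := by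
    have := hpos (Pi.single i 1) (fun j hj => by
      rw [Pi.single_eq_of_ne]; rintro rfl; exact hj (Finset.mem_insert_self _ _))
      (by simp)
    simpa using this
  set s := Real.sqrt (Q i i)
  have hs0 : 0 < s := Real.sqrt_pos.2 hQii
  have hss : s * s = Q i i := Real.mul_self_sqrt hQii.le
  -- One step of Cholesky elimination: this scaling makes `l lᵀ` agree with `Q` in row and column
  -- `i`, so the Schur complement `Q'` no longer involves the variable `i`.
  let l : Fin n → ℝ := fun j => Q i j / s
  have hli : l i = s := by
    simp only [l]; rw [← hss]; field_simp
  let Q' : Matrix (Fin n) (Fin n) ℝ := Q - vecMulVec l l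
  have hl : ∀ j, j ≠ i → j ∉ A → l j = 0 := by
    intro j hj hjA
    simp only [l]
    rw [hsymm, hsupp j (by simp [hj, hjA]), zero_div]
  have hQ'symm : ∀ j k, Q' j k = Q' k j := by
    intro j k
    simp only [Q', Matrix.sub_apply, vecMulVec_apply]
    rw [hsymm j k]; ring
  have hQ'supp : ∀ j, j ∉ A → ∀ k, Q' j k = 0 := by
    intro j hj k
    simp only [Q', Matrix.sub_apply, vecMulVec_apply]
    by_cases hji : j = i
    · subst hji
      rw [hli]; simp only [l]; field_simp; ring
    · rw [hl j hji hj, hsupp j (by simp [hji, hj])]; ring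
  have hsplit : ∀ y : Fin n → ℝ, y ⬝ᵥ Q *ᵥ y = (l ⬝ᵥ y) ^ 2 + y ⬝ᵥ Q' *ᵥ y := by
    intro y
    simp only [Q', sub_mulVec, dotProduct_sub, vecMulVec_mulVec, dotProduct_smul]
    simp [dotProduct_comm y l]
    ring
  have hcongr : ∀ y z : Fin n → ℝ, (∀ j, j ≠ i → y j = z j) → y ⬝ᵥ Q' *ᵥ y = z ⬝ᵥ Q' *ᵥ z := by
    intro y z hyz
    have hmul : Q' *ᵥ y = Q' *ᵥ z := by
      funext j
      simp only [mulVec, dotProduct]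
      refine Finset.sum_congr rfl fun k _ => ?_
      by_cases hk : k = i
      · subst hk
        rw [hQ'symm, hQ'supp k hi]; simp
      · rw [hyz k hk]
    rw [hmul]
    refine Finset.sum_congr rfl fun k _ => ?_
    by_cases hk : k = i
    · subst hk
      have : (Q' *ᵥ z) k = 0 := by
        simp [mulVec, dotProduct, hQ'supp k hi]
      rw [this]; simp
    · rw [hyz k hk]
  have hlupd : ∀ (y : Fin n → ℝ) (t : ℝ), l ⬝ᵥ Function.update y i t =
      s * t + (l ⬝ᵥ y - s * y i) := by
    intro y t
    have hup : Function.update y i t = y + Pi.single i (t - y i) := by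
      funext j
      by_cases hj : j = i
      · subst hj; simp
      · simp [hj]
    rw [hup, dotProduct_add, dotProduct_single, hli]; ring
  have hQ'pos : ∀ y : Fin n → ℝ, (∀ j, j ∉ A → y j = 0) → y ≠ 0 → 0 < y ⬝ᵥ Q' *ᵥ y := by
    intro y hy hy0
    -- Coordinate `i` is free for `Q'`; choosing it so that the square `(l ⬝ᵥ y)²` vanishes makes
    -- the two forms agree, and positivity passes from `Q` to `Q'`.
    have hz : l ⬝ᵥ Function.update y i (-(l ⬝ᵥ y) / s) = 0 := by
      rw [hlupd, hy i hi]; field_simp; ring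
    have hzQ := hpos (Function.update y i (-(l ⬝ᵥ y) / s)) (fun j hj => by
        rw [Finset.mem_insert, not_or] at hj
        rw [Function.update_of_ne hj.1, hy j hj.2]) (fun h0 => hy0 (by
        funext j
        by_cases hj : j = i
        · subst hj; exact hy j hi
        · have := congrFun h0 j
          rwa [Function.update_of_ne hj] at this))
    rw [hsplit, hz, hcongr _ y (fun j hj => Function.update_of_ne hj _ _)] at hzQ
    simpa using hzQ
  have hgx : ∀ x, g x = ENNReal.ofReal
      (c * (Real.sqrt (2 * Real.pi) / s) * Real.exp (-((x - μ) ⬝ᵥ Q' *ᵥ (x - μ)) / 2)) := by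
    intro x
    have hfun : ∀ t : ℝ, f (Function.update x i t) =
        ENNReal.ofReal (c * Real.exp (-((x - μ) ⬝ᵥ Q' *ᵥ (x - μ)) / 2)) *
        ENNReal.ofReal (Real.exp (-(s * t + (l ⬝ᵥ (x - μ) - s * x i)) ^ 2 / 2)) := by
      intro t
      have hup : Function.update x i t - μ = Function.update (x - μ) i (t - μ i) := by
        funext j
        by_cases hj : j = i
        · subst hj; simp
        · simp [hj]
      rw [hf, hup, hsplit, hlupd, hcongr _ (x - μ) (fun j hj => Function.update_of_ne hj _ _),
        ← ENNReal.ofReal_mul (by positivity), mul_assoc, ← Real.exp_add]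
      congr 3
      simp only [Pi.sub_apply]
      ring
    rw [hg]
    simp_rw [hfun]
    rw [lintegral_const_mul' _ _ ENNReal.ofReal_ne_top, lintegral_exp_neg_sq_affine hs0,
      ← ENNReal.ofReal_mul (by positivity)]
    congr 1
    ring
  refine ⟨⟨c * (Real.sqrt (2 * Real.pi) / s), by positivity, Q', hQ'symm, hQ'supp, hQ'pos, hgx⟩,
    l, hli ▸ hs0, hl, fun x => ?_⟩
  rw [hgx, hf, ← ENNReal.ofReal_div_of_pos (by positivity), hsplit, hli]
  congr 1
  rw [show -((l ⬝ᵥ (x - μ)) ^ 2 + (x - μ) ⬝ᵥ Q' *ᵥ (x - μ)) / 2 =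
    -(l ⬝ᵥ (x - μ)) ^ 2 / 2 + -((x - μ) ⬝ᵥ Q' *ᵥ (x - μ)) / 2 by ring, Real.exp_add]
  field_simp

theorem marginalDensity_eq_lintegral {n : ℕ} {p : (Fin n → ℝ) → ENNReal} (hp : Measurable p)
    {A : Finset (Fin n)} {i : Fin n} (hi : i ∉ A) (x : Fin n → ℝ) :
    marginalDensity p A x = ∫⁻ t : ℝ, marginalDensity p (insert i A) (Function.update x i t) := by
  have h : Aᶜ = insert i (insert i A)ᶜ := by
    ext j
    by_cases hj : j = i
    · subst hj; simp [hi]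
    · simp [hj]
  unfold marginalDensity
  rw [h, lmarginal_insert _ hp (by simp)]

theorem isGaussianOn_marginalDensity {n : ℕ} {μ : Fin n → ℝ} {p : (Fin n → ℝ) → ENNReal}
    (hp : Measurable p) (hG : IsGaussianOn μ Finset.univ p) (A : Finset (Fin n)) :
    IsGaussianOn μ A (marginalDensity p A) := by
  suffices h : ∀ B A : Finset (Fin n), Aᶜ = B → IsGaussianOn μ A (marginalDensity p A) from
    h _ A rfl
  -- Induction on the set of variables integrated out, one at a time.
  intro B
  induction B using Finset.induction_on with
  | empty =>
    intro A hA
    rw [Finset.compl_eq_empty_iff] at hA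
    subst hA
    have : marginalDensity p Finset.univ = p := by
      funext x
      simp [marginalDensity]
    rwa [this]
  | insert i B hiB ih =>
    intro A hA
    have hi : i ∉ A := by
      rw [← Finset.mem_compl, hA]; exact Finset.mem_insert_self _ _
    refine (IsGaussianOn.integrate_out hi (ih (insert i A) ?_)
      (marginalDensity_eq_lintegral hp hi)).1
    rw [Finset.compl_insert, hA, Finset.erase_insert hiB]

theorem exists_condDensity_singleton {n : ℕ} {μ : Fin n → ℝ} {p : (Fin n → ℝ) → ENNReal}
    (hp : Measurable p) (hG : IsGaussianOn μ Finset.univ p) {A : Finset (Fin n)} {i : Fin n}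
    (hi : i ∉ A) :
    ∃ l : Fin n → ℝ, 0 < l i ∧ (∀ j, j ≠ i → j ∉ A → l j = 0) ∧
      ∀ x, condDensity p {i} A x = ENNReal.ofReal
        (l i / Real.sqrt (2 * Real.pi) * Real.exp (-(l ⬝ᵥ (x - μ)) ^ 2 / 2)) := by
  have h := (IsGaussianOn.integrate_out hi (isGaussianOn_marginalDensity hp hG (insert i A))
    (marginalDensity_eq_lintegral hp hi)).2
  unfold condDensity
  rwa [Finset.union_comm A {i}, ← Finset.insert_eq]

/-- The chain rule for conditional densities. -/
theorem condDensity_eq_prod {n : ℕ} {p : (Fin n → ℝ) → ENNReal} {x : Fin n → ℝ}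
    (h0 : ∀ A, marginalDensity p A x ≠ 0) (hT : ∀ A, marginalDensity p A x ≠ ⊤)
    (A B : Finset (Fin n)) :
    condDensity p B A x = ∏ i ∈ B, condDensity p {i} (A ∪ B.filter (· < i)) x := by
  induction B using Finset.induction_on_max with
  | empty => simp [condDensity, ENNReal.div_self (h0 A) (hT A)]
  | insert a s hs ih =>
    have has : a ∉ s := fun h => lt_irrefl _ (hs a h)
    have h1 : (insert a s).filter (· < a) = s := by
      rw [Finset.filter_insert, if_neg (lt_irrefl a), Finset.filter_true_of_mem hs]
    have h2 : ∀ i ∈ s, (insert a s).filter (· < i) = s.filter (· < i) := fun i hi => by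
      rw [Finset.filter_insert, if_neg (hs i hi).not_gt]
    rw [Finset.prod_insert has, h1, Finset.prod_congr rfl fun i hi => by rw [h2 i hi], ← ih]
    unfold condDensity
    rw [show A ∪ insert a s = A ∪ s ∪ {a} by
      rw [Finset.union_assoc, Finset.union_comm s, ← Finset.insert_eq]]
    -- The quotients telescope; cancelling in `[0, ∞]` needs the marginal to be nonzero and finite.
    rw [div_eq_mul_inv, div_eq_mul_inv, div_eq_mul_inv, mul_assoc, ← mul_assoc _⁻¹,
      ENNReal.inv_mul_cancel (h0 _) (hT _), one_mul]

/-! ### Combinatorics of the conditioning sets -/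

namespace HierPartition

variable {n M : ℕ} {J : ℕ → ℕ} (X : HierPartition n M J)

theorem block_unique {i : Fin n} {a b : Node M J} (ha : i ∈ X.block a) (hb : i ∈ X.block b) :
    a = b := by
  by_contra h
  exact Finset.disjoint_left.1 (X.disjoint a b h) ha hb

theorem mem_ancestors {k : Fin n} {a : Node M J} :
    k ∈ X.ancestors a ↔ ∃ l : Fin a.1, k ∈ X.block (a.truncate l) := by
  simp [ancestors]

theorem condSet_eq {i : Fin n} {a : Node M J} (ha : i ∈ X.block a) :
    X.condSet i = X.ancestors a ∪ (X.block a).filter (· < i) := by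
  ext k
  simp only [condSet, Finset.mem_filter, Finset.mem_univ, true_and, Finset.mem_union]
  constructor
  · rintro ⟨b, hb, h⟩
    rwa [X.block_unique ha hb]
  · exact fun h => ⟨a, ha, h⟩

/-- An ancestor block has strictly lower resolution, so the ordering by resolution puts its
variables earlier. -/
theorem lt_of_mem_condSet {i k : Fin n} (hk : k ∈ X.condSet i) : k < i := by
  obtain ⟨a, ha⟩ := X.cover i
  rw [X.condSet_eq ha, Finset.mem_union, Finset.mem_filter, mem_ancestors] at hk
  rcases hk with ⟨l, hl⟩ | ⟨-, h⟩
  · by_contra hlt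
    have hla : (a.truncate l).1 < a.1 := l.isLt
    rcases (not_lt.1 hlt).eq_or_lt with h | h
    · subst h
      have := X.block_unique ha hl
      rw [← this] at hla
      exact lt_irrefl _ hla
    · exact absurd (X.ordered k i _ _ h hl ha) (not_le.2 hla)
  · exact h

/-- A truncation of a truncation is a truncation, and variables in one block share their ancestors.
-/
theorem condSet_trans {i j k : Fin n} (hj : j ∈ X.condSet i) (hk : k ∈ X.condSet j) :
    k ∈ X.condSet i := by
  have hkj := X.lt_of_mem_condSet hk
  obtain ⟨a, ha⟩ := X.cover i
  rw [X.condSet_eq ha, Finset.mem_union, Finset.mem_filter] at hj ⊢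
  rcases hj with hj | ⟨hj, hji⟩
  · obtain ⟨l, hl⟩ := X.mem_ancestors.1 hj
    rw [X.condSet_eq hl, Finset.mem_union, Finset.mem_filter] at hk
    refine Or.inl (X.mem_ancestors.2 ?_)
    rcases hk with hk | ⟨hk, -⟩
    · obtain ⟨m, hm⟩ := X.mem_ancestors.1 hk
      exact ⟨⟨m, m.isLt.trans l.isLt⟩, hm⟩
    · exact ⟨l, hk⟩
  · rw [X.condSet_eq hj, Finset.mem_union, Finset.mem_filter] at hk
    exact hk.imp_right fun h => ⟨h.1, h.2.trans hji⟩

theorem approx_eq_prod {p : (Fin n → ℝ) → ENNReal} {x : Fin n → ℝ}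
    (h0 : ∀ A, marginalDensity p A x ≠ 0) (hT : ∀ A, marginalDensity p A x ≠ ⊤) :
    X.approx p x = ∏ i, condDensity p {i} (X.condSet i) x := by
  have hU : (Finset.univ : Finset (Fin n)) = Finset.univ.biUnion X.block := by
    ext i
    simpa using X.cover i
  rw [hU, Finset.prod_biUnion fun a _ b _ hab => X.disjoint a b hab]
  refine Finset.prod_congr rfl fun a _ => ?_
  rw [condDensity_eq_prod h0 hT]
  exact Finset.prod_congr rfl fun i hi => by rw [X.condSet_eq hi]

end HierPartition

/-! ### Triangular matrices and Cholesky factors -/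

/-- A right inverse of a matrix whose pattern is a strictly decreasing transitive relation,
together with the diagonal, has the same pattern. -/
theorem apply_eq_zero_of_mul_eq_one {n : ℕ} {W L : Matrix (Fin n) (Fin n) ℝ}
    {C : Fin n → Finset (Fin n)} (hlt : ∀ i, ∀ k ∈ C i, k < i)
    (htrans : ∀ i, ∀ j ∈ C i, C j ⊆ C i) (hd : ∀ i, 0 < W i i)
    (hW : ∀ i j, j ≠ i → j ∉ C i → W i j = 0) (hWL : W * L = 1) (i j : Fin n) (hij : j ≠ i)
    (hj : j ∉ C i) : L i j = 0 := by
  induction i using WellFoundedLT.induction with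
  | ind i ih =>
    -- In entry `(i, j)` of `W L = 1`, the terms with `k ∈ C i` vanish by induction and
    -- transitivity, so only `W i i * L i j = 0` remains.
    have h := congrFun (congrFun hWL i) j
    rw [mul_apply, one_apply_ne hij.symm, Finset.sum_eq_single i] at h
    · exact (mul_eq_zero.1 h).resolve_left (hd i).ne'
    · intro k _ hki
      by_cases hk : k ∈ C i
      · rw [ih k (hlt i k hk) (fun h => hj (h ▸ hk)) (fun h => hj (htrans i k hk h)), mul_zero]
      · rw [hW i k hki hk, zero_mul]
    · simp

/-- Column `j` is determined by the earlier columns: the diagonal entry is a positive square root,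
and the other entries follow by division. -/
theorem IsChol.unique {n : ℕ} {A L L' : Matrix (Fin n) (Fin n) ℝ} (h : IsChol A L)
    (h' : IsChol A L') : L = L' := by
  have key : ∀ {L : Matrix (Fin n) (Fin n) ℝ}, IsChol A L → ∀ i j,
      A i j = L i j * L j j + ∑ k with k < j, L i k * L j k := by
    intro L hL i j
    rw [← hL.2.2, mul_apply, ← Finset.add_sum_erase _ _ (Finset.mem_univ j), transpose_apply]
    congr 1
    symm
    refine Finset.sum_subset (fun k hk => ?_) (fun k hk hk' => ?_)
    · simpa using (Finset.mem_filter.1 hk).2.ne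
    · have hjk : j < k := lt_of_le_of_ne (not_lt.1 (by simpa using hk'))
        (Finset.ne_of_mem_erase hk).symm
      rw [hL.1 j k hjk, mul_zero]
  suffices H : ∀ j i, L i j = L' i j by
    ext i j
    exact H j i
  intro j
  induction j using WellFoundedLT.induction with
  | ind j ih =>
    have hmul : ∀ i, L i j * L j j = L' i j * L' j j := by
      intro i
      have h1 := (key h i j).symm.trans (key h' i j)
      rwa [Finset.sum_congr rfl fun k hk => by
        rw [ih k (Finset.mem_filter.1 hk).2, ih k (Finset.mem_filter.1 hk).2],
        add_left_inj] at h1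
    have hdiag : L j j = L' j j :=
      (mul_self_inj (h.2.1 j).le (h'.2.1 j).le).1 (hmul j)
    intro i
    have := hmul i
    rw [hdiag] at this
    exact mul_right_cancel₀ (h'.2.1 j).ne' this

theorem IsChol.chol_eq {n : ℕ} {A L : Matrix (Fin n) (Fin n) ℝ} (h : IsChol A L) :
    chol A = L := by
  have hex : ∃ L, IsChol A L := ⟨L, h⟩
  rw [chol, dif_pos hex]
  exact hex.choose_spec.unique h

theorem reversal_mul_mul_reversal {n : ℕ} (A : Matrix (Fin n) (Fin n) ℝ) :
    reversal n * A * reversal n = A.submatrix Fin.rev Fin.rev := by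
  ext i j
  simp [reversal, PEquiv.toMatrix_toPEquiv_mul, PEquiv.mul_toMatrix_toPEquiv,
    Equiv.Perm.permMatrix]

/-- Reversing the order of rows and columns turns upper triangular into lower triangular and
respects products. -/
theorem isChol_reversal {n : ℕ} {A U : Matrix (Fin n) (Fin n) ℝ} (hU : ∀ i j, j < i → U i j = 0)
    (hd : ∀ i, 0 < U i i) (hA : U * U.transpose = A) :
    IsChol (reversal n * A * reversal n) (reversal n * U * reversal n) := by
  rw [reversal_mul_mul_reversal, reversal_mul_mul_reversal]
  refine ⟨fun i j hij => hU _ _ (Fin.rev_lt_rev.2 hij), fun i => hd _, ?_⟩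
  rw [← hA, transpose_submatrix]
  exact submatrix_mul_equiv U U.transpose Fin.rev Fin.revPerm Fin.rev

theorem rchol_eq {n : ℕ} {A U : Matrix (Fin n) (Fin n) ℝ} (hU : ∀ i j, j < i → U i j = 0)
    (hd : ∀ i, 0 < U i i) (hA : U * U.transpose = A) : rchol A = U := by
  rw [rchol, (isChol_reversal hU hd hA).chol_eq, reversal_mul_mul_reversal,
    reversal_mul_mul_reversal]
  ext i j
  simp

/-- A product of univariate Gaussian factors with triangular coefficients is a multivariate Gaussian
density. -/
theorem prod_eq_gaussianDensity {n : ℕ} (μ : Fin n → ℝ) {W : Matrix (Fin n) (Fin n) ℝ}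
    (hd : ∀ i, 0 < W i i) (hdet : W.det = ∏ i, W i i) (x : Fin n → ℝ) :
    ∏ i, ENNReal.ofReal
      (W i i / Real.sqrt (2 * Real.pi) * Real.exp (-(W i ⬝ᵥ (x - μ)) ^ 2 / 2)) =
      gaussianDensity μ (Wᵀ * W)⁻¹ x := by
  have hpos : 0 < W.det := hdet ▸ Finset.prod_pos fun i _ => hd i
  have hunit : IsUnit (Wᵀ * W).det := by
    rw [det_mul, det_transpose]
    exact (mul_pos hpos hpos).ne'.isUnit
  rw [← ENNReal.ofReal_prod_of_nonneg fun i _ => by have := hd i; positivity, gaussianDensity,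
    gaussianDensityReal, nonsing_inv_nonsing_inv _ hunit, Finset.prod_mul_distrib,
    ← Real.exp_sum, Finset.prod_div_distrib, ← hdet]
  congr 2
  · have hsq : (2 * Real.pi) ^ n * (W.det * W.det)⁻¹ =
        (Real.sqrt (2 * Real.pi) ^ n / W.det) ^ 2 := by
      rw [div_pow, ← pow_mul, mul_comm n 2, pow_mul, Real.sq_sqrt (by positivity)]
      field_simp
    rw [det_nonsing_inv, Ring.inverse_eq_inv', det_mul, det_transpose, hsq,
      Real.sqrt_sq (by positivity)]
    simp
  · rw [← mulVec_mulVec, dotProduct_mulVec, vecMul_transpose, ← Finset.sum_div,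
      Finset.sum_neg_distrib]
    simp [dotProduct, mulVec, pow_two]

end HierVecchia

/-! ### Assembly -/

theorem proposition1 (n M : ℕ) (J : ℕ → ℕ) (X : HierVecchia.HierPartition n M J)
    (μ : Fin n → ℝ) (S : Matrix (Fin n) (Fin n) ℝ) (hS : S.PosDef) :
    ∃ S' : Matrix (Fin n) (Fin n) ℝ, S'.PosDef ∧
      (∀ x, X.approx (HierVecchia.gaussianDensity μ S) x = HierVecchia.gaussianDensity μ S' x) ∧
      HierVecchia.IsChol S' (HierVecchia.chol S') ∧
      HierVecchia.IsChol
        (HierVecchia.reversal n * S'⁻¹ * HierVecchia.reversal n)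
        (HierVecchia.chol (HierVecchia.reversal n * S'⁻¹ * HierVecchia.reversal n)) ∧
      (∀ i j : Fin n, i ≠ j → j ∉ X.condSet i →
        HierVecchia.chol S' i j = 0 ∧ HierVecchia.rchol S'⁻¹ j i = 0) ∧
      HierVecchia.rchol S'⁻¹ = ((HierVecchia.chol S')⁻¹).transpose := by
  have hp := HierVecchia.measurable_gaussianDensity μ S
  have hG := HierVecchia.isGaussianOn_gaussianDensity μ hS
  have hmarg := HierVecchia.isGaussianOn_marginalDensity hp hG
  choose W hd hW hcond using fun i => HierVecchia.exists_condDensity_singleton hp hG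
    (A := X.condSet i) (i := i) fun h => lt_irrefl _ (X.lt_of_mem_condSet h)
  replace hW : ∀ i j, j ≠ i → j ∉ X.condSet i → (Matrix.of W) i j = 0 := hW
  have hlow : ∀ i j, i < j → (Matrix.of W) i j = 0 := fun i j hij =>
    hW i j hij.ne' fun h => (X.lt_of_mem_condSet h).not_gt hij
  have hdet : (Matrix.of W).det = ∏ i, (Matrix.of W) i i :=
    Matrix.det_of_isLowerTriangular _ fun i j hij => hlow i j hij
  have hdetpos : 0 < (Matrix.of W).det := hdet ▸ Finset.prod_pos fun i _ => hd i
  set V : Matrix (Fin n) (Fin n) ℝ := Matrix.of W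
  have hVunit : IsUnit V.det := hdetpos.ne'.isUnit
  have hVL : V * V⁻¹ = 1 := Matrix.mul_nonsing_inv _ hVunit
  have hL := HierVecchia.apply_eq_zero_of_mul_eq_one
    (fun i k hk => X.lt_of_mem_condSet hk) (fun i j hj k hk => X.condSet_trans hj hk) hd hW hVL
  have hLlow : ∀ i j, i < j → V⁻¹ i j = 0 := fun i j hij =>
    hL i j hij.ne' fun h => (X.lt_of_mem_condSet h).not_gt hij
  have hLd : ∀ i, 0 < V⁻¹ i i := by
    intro i
    have h := congrFun (congrFun hVL i) i
    rw [Matrix.mul_apply, Matrix.one_apply_eq, Finset.sum_eq_single i] at h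
    · exact pos_of_mul_pos_right (h ▸ one_pos) (hd i).le
    · intro k _ hki
      rcases lt_or_gt_of_ne hki with hk | hk
      · rw [hLlow k i hk, mul_zero]
      · rw [hlow i k hk, zero_mul]
    · simp
  have hprec : (V.transpose * V).PosDef := by
    have := Matrix.PosDef.conjTranspose_mul_self V
      (Matrix.mulVec_injective_iff_isUnit.2 ((Matrix.isUnit_iff_isUnit_det V).2 hVunit))
    rwa [Matrix.conjTranspose_eq_transpose_of_trivial] at this
  have hinv : (V.transpose * V)⁻¹⁻¹ = V.transpose * V :=
    Matrix.nonsing_inv_nonsing_inv _ ((Matrix.isUnit_iff_isUnit_det _).1 hprec.isUnit)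
  -- `(Vᵀ V)⁻¹ = V⁻¹ V⁻ᵀ` with `V⁻¹` lower triangular.
  have hchol : HierVecchia.IsChol (V.transpose * V)⁻¹ V⁻¹ := by
    refine ⟨hLlow, hLd, ?_⟩
    rw [Matrix.mul_inv_rev, Matrix.transpose_nonsing_inv]
  have hup : ∀ i j, j < i → V.transpose i j = 0 := fun i j hij => hlow j i hij
  have hUU : V.transpose * V.transpose.transpose = V.transpose * V := by
    rw [Matrix.transpose_transpose]
  have hrchol := HierVecchia.rchol_eq hup hd hUU
  have hrev := HierVecchia.isChol_reversal hup hd hUU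
  refine ⟨(V.transpose * V)⁻¹, hprec.inv, fun x => ?_, ?_, ?_, ?_, ?_⟩
  · rw [X.approx_eq_prod (fun A => (hmarg A).ne_zero x) fun A => (hmarg A).ne_top x,
      ← HierVecchia.prod_eq_gaussianDensity (W := V) μ hd hdet]
    exact Finset.prod_congr rfl fun i _ => hcond i x
  -- This goal and the next rule out the default value `0` of `chol`.
  · rwa [hchol.chol_eq]
  · rwa [hinv, hrev.chol_eq]
  · intro i j hij hj
    rw [hinv, hchol.chol_eq, hrchol]
    exact ⟨hL i j hij.symm hj, hW i j hij.symm hj⟩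
  · rw [hinv, hchol.chol_eq, hrchol, Matrix.nonsing_inv_nonsing_inv _ hVunit]
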